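/- For $m,d\in\mathbb{N}$ let $\Delta_d=\{\alpha\in\mathbb{N}^m : |\alpha|=\alpha_1+\dots+\alpha_m\le d\}$ (and $\Delta_{-1}=\emptyset$). For $\mathbf z\in\mathbb{C}^m$ write $\mathbf z^\alpha=z_1^{\alpha_1}\cdots z_m^{\alpha_m}$. For a finite set $\mathcal C\subset\mathbb{N}^m$ put $2\mathcal C=\{\alpha+\beta:\alpha,\beta\in\mathcal C\}$; the quasi-Hankel matrix of an array $h=(h_\alpha)_{\alpha\in 2\mathcal C}$ of complex numbers is $\mathscr H_{\mathcal C}(h)=[h_{\alpha+\beta}]_{\alpha,\beta\in\mathcal C}$, and points $\mathbf z_1,\dots,\mathbf z_r\in\mathbb{C}^m$ are called $\mathcal C$-independent if the matrix $[\mathbf z_k^{\alpha}]_{\alpha\in\mathcal C,\,1\le k\le r}$ has rank $r$. Let $\mathcal A=\Delta_d$, $d'=\lfloor d/2\rfloor$ and $\mathcal B=\Delta_{d'}$. Let complex numbers $(h_\alpha)_{\alpha\in\mathcal A}$ (the known entries) be given and consider the problem of minimizing $\operatorname{rank}\mathscr H_{\mathcal A}(g)$ over all completions, i.e. all arrays $g=(g_\alpha)_{\alpha\in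 2\mathcal A}$ of complex numbers with $g_\alpha=h_\alpha$ for all $\alpha\in\mathcal A$. Suppose that $$h_\alpha=\sum_{k=1}^r c_k\,\mathbf z_k^{\alpha}\qquad(\alpha\in\mathcal A),$$ where $c_1,\dots,c_r\in\mathbb{C}$ are nonzero and the points $\mathbf z_1,\dots,\mathbf z_r\in\mathbb{C}^m$ are $\mathcal B$-independent. Then: 1. The minimal rank of a completion is $r$, and it is attained by the canonical completion, which is defined by the same formula $\sum_{k=1}^r c_k\,\mathbf z_k^{\alpha}$ for all $\alpha\in 2\mathcal A$. 2. If $d$ is odd, the canonical completion is the only completion of minimal rank. 3. If $d$ is even and $\mathbf z_1,\dots,\mathbf z_r$ are $\Delta_{d'-1}$-independent, the canonical completion is the only completion of minimal rank. -/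

import Mathlib

open scoped Pointwise

/-- The set of multi-indices `α ∈ ℕ^m` of total degree `|α| ≤ d`. -/
def trgSet (m d : ℕ) : Finset (Fin m → ℕ) :=
  (Fintype.piFinset fun _ => Finset.range (d + 1)).filter fun α => ∑ i, α i ≤ d

theorem mem_trgSet {m d : ℕ} {α : Fin m → ℕ} : α ∈ trgSet m d ↔ ∑ i, α i ≤ d := by
  simp only [trgSet, Finset.mem_filter, Fintype.mem_piFinset, Finset.mem_range,
    and_iff_right_iff_imp]
  intro h i
  have := Finset.single_le_sum (f := α) (fun j _ => Nat.zero_le _) (Finset.mem_univ i)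
  omega

theorem trgSet_subset_add_self (m d : ℕ) : trgSet m d ⊆ trgSet m d + trgSet m d := by
  intro α h
  exact Finset.mem_add.2 ⟨α, h, 0, mem_trgSet.2 (by simp), add_zero α⟩

/-- The monomial `z^α = z₁^α₁ ⋯ z_m^α_m`. -/
def monom {m : ℕ} (z : Fin m → ℂ) (α : Fin m → ℕ) : ℂ := ∏ i, z i ^ α i

/-- The quasi-Hankel matrix `[h_{α+β}]_{α,β ∈ C}` of an array `h` indexed by `2C = C + C`. -/
def quasiHankel {m : ℕ} (C : Finset (Fin m → ℕ)) (h : ↥(C + C) → ℂ) : Matrix ↥C ↥C ℂ :=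
  Matrix.of fun α β => h ⟨α.1 + β.1, Finset.add_mem_add α.2 β.2⟩

/-- The quasi-Vandermonde matrix `[z_j^α]` with rows `α ∈ C` and columns `j`. -/
def quasiVandermonde {m r : ℕ} (C : Finset (Fin m → ℕ)) (z : Fin r → Fin m → ℂ) :
    Matrix ↥C (Fin r) ℂ :=
  Matrix.of fun α j => monom (z j) α.1

/-- The points `z₁, …, z_r` are `C`-independent. -/
def IndependentPoints {m r : ℕ} (C : Finset (Fin m → ℕ)) (z : Fin r → Fin m → ℂ) : Prop :=
  (quasiVandermonde C z).rank = r

/-- The exponential array `h_α = ∑_k c_k z_k^α` on an index set `D`. -/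
def expArray {m r : ℕ} (D : Finset (Fin m → ℕ)) (c : Fin r → ℂ) (z : Fin r → Fin m → ℂ) :
    ↥D → ℂ :=
  fun α => ∑ k, c k * monom (z k) α.1

/-- `g`, an array on `2A` with `A = trgSet m d`, completes the array `h` of known entries
on `A`. -/
def IsCompletion {m d : ℕ} (h : ↥(trgSet m d) → ℂ) (g : ↥(trgSet m d + trgSet m d) → ℂ) :
    Prop :=
  ∀ α : ↥(trgSet m d), g ⟨α.1, trgSet_subset_add_self m d α.2⟩ = h α

/-- `g` is a solution of the rank minimization problem with known entries `h`. -/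
def IsMinRankCompletion {m d : ℕ} (h : ↥(trgSet m d) → ℂ)
    (g : ↥(trgSet m d + trgSet m d) → ℂ) : Prop :=
  IsCompletion h g ∧ ∀ g' : ↥(trgSet m d + trgSet m d) → ℂ, IsCompletion h g' →
    (quasiHankel (trgSet m d) g).rank ≤ (quasiHankel (trgSet m d) g').rank

open scoped Matrix

/-! ### Rank and left inverses of complex matrices -/

section MatrixRank

variable {ι κ l : Type*} [Fintype κ]

/-! If `2s ≤ d`, the block of degrees at most `s` is known and factors as `V D Vᵀ`; independence
makes its rank `r`, which bounds every completion from below. If moreover `2s + 1 ≤ d`, a completion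
of rank `r` is rigid (`eq_expArray_of_rank_le`): its column space is determined by the rows of
degree at most `s`. A left inverse of `V` combines columns into vectors `u k` that look like `c_k
z_k^α` in degrees at most `s + 1`. Rigidity propagates the relation "shift by `e_i` = multiplication
by `z k i`" to all rows, so every column is a combination of the `u k`; the symmetry of the matrix
then identifies `u k`. -/

theorem Matrix.exists_mul_eq_one_of_rank_eq_card [Fintype ι] [DecidableEq κ]
    (V : Matrix ι κ ℂ) (h : V.rank = Fintype.card κ) : ∃ X : Matrix κ ι ℂ, X * V = 1 := by
  rw [← Matrix.vecMul_surjective_iff_exists_left_inverse]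
  have h1 : LinearMap.range Vᵀ.mulVecLin = ⊤ := by
    apply Submodule.eq_top_of_finrank_eq
    rw [← Matrix.rank, Matrix.rank_transpose, h, Module.finrank_fintype_fun_eq_card]
  intro w
  obtain ⟨x, hx⟩ := LinearMap.range_eq_top.1 h1 w
  exact ⟨x, by simpa [Matrix.mulVec_transpose] using hx⟩

/-- If some rows of `M` already carry its full rank, a vector of the column space that vanishes
on these rows is zero. -/
theorem Matrix.mulVec_eq_zero_of_rank_le_rank_submatrix (M : Matrix ι κ ℂ) (f : l → ι)
    (h : M.rank ≤ (M.submatrix f id).rank) (x : κ → ℂ) (hx : ∀ i, (M *ᵥ x) (f i) = 0) :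
    M *ᵥ x = 0 := by
  have hle : LinearMap.ker M.mulVecLin ≤ LinearMap.ker (M.submatrix f id).mulVecLin := by
    intro y hy
    rw [LinearMap.mem_ker, Matrix.mulVecLin_apply] at hy ⊢
    funext i
    exact congrFun hy (f i)
  have h1 := LinearMap.finrank_range_add_finrank_ker M.mulVecLin
  have h2 := LinearMap.finrank_range_add_finrank_ker (M.submatrix f id).mulVecLin
  rw [← Matrix.rank] at h1 h2
  -- By rank–nullity, the nested kernels have equal dimension.
  have heq := Submodule.eq_of_le_of_finrank_le hle (by omega)
  have : x ∈ LinearMap.ker M.mulVecLin := by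
    rw [heq, LinearMap.mem_ker, Matrix.mulVecLin_apply]
    funext i
    exact hx i
  simpa using this

end MatrixRank

/-! ### Monomials and the Vandermonde factorization -/

section Monomials

variable {m r : ℕ}

theorem monom_add (z : Fin m → ℂ) (α β : Fin m → ℕ) :
    monom z (α + β) = monom z α * monom z β := by
  simp [monom, pow_add, Finset.prod_mul_distrib]

theorem monom_single (z : Fin m → ℂ) (i : Fin m) : monom z (Pi.single i 1) = z i := by
  rw [monom, Finset.prod_eq_single i]
  · simp
  · intro j _ hj
    simp [hj]
  · simp

theorem add_mem_trgSet {a b d : ℕ} {α β : Fin m → ℕ} (hα : α ∈ trgSet m a)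
    (hβ : β ∈ trgSet m b) (h : a + b ≤ d) : α + β ∈ trgSet m d := by
  rw [mem_trgSet] at *
  simp only [Pi.add_apply, Finset.sum_add_distrib]
  omega

theorem trgSet_mono {a b : ℕ} (h : a ≤ b) : trgSet m a ⊆ trgSet m b := fun _ hα =>
  mem_trgSet.2 ((mem_trgSet.1 hα).trans h)

theorem single_mem_trgSet (i : Fin m) : Pi.single i 1 ∈ trgSet m 1 :=
  mem_trgSet.2 (by simp)

theorem exists_add_single_of_mem_trgSet_succ {n : ℕ} {β : Fin m → ℕ}
    (hβ : β ∈ trgSet m (n + 1)) (h0 : β ∉ trgSet m n) :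
    ∃ γ ∈ trgSet m n, ∃ i, β = γ + Pi.single i 1 := by
  rw [mem_trgSet] at hβ h0
  obtain ⟨i, -, hi⟩ := Finset.exists_ne_zero_of_sum_ne_zero
    (show ∑ i, β i ≠ 0 by omega)
  have key : β = (β - Pi.single i 1) + Pi.single i 1 := by
    funext j
    by_cases hj : j = i
    · subst hj
      simp
      omega
    · simp [hj]
  refine ⟨β - Pi.single i 1, ?_, i, key⟩
  rw [mem_trgSet]
  have := congrArg (fun f : Fin m → ℕ => ∑ j, f j) key
  simp only [Pi.add_apply, Finset.sum_add_distrib, Finset.sum_pi_single', Finset.mem_univ,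
    if_true] at this
  omega

theorem quasiHankel_expArray (C : Finset (Fin m → ℕ)) (c : Fin r → ℂ) (z : Fin r → Fin m → ℂ) :
    quasiHankel C (expArray (C + C) c z) =
      quasiVandermonde C z * Matrix.diagonal c * (quasiVandermonde C z)ᵀ := by
  ext α β
  rw [Matrix.mul_apply]
  simp only [quasiHankel, expArray, quasiVandermonde, Matrix.of_apply,
    Matrix.mul_diagonal, Matrix.transpose_apply, monom_add]
  exact Finset.sum_congr rfl fun k _ => by ring

theorem rank_quasiHankel_expArray_le (C : Finset (Fin m → ℕ)) (c : Fin r → ℂ)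
    (z : Fin r → Fin m → ℂ) : (quasiHankel C (expArray (C + C) c z)).rank ≤ r := by
  rw [quasiHankel_expArray]
  refine (Matrix.rank_mul_le_right _ _).trans ?_
  simpa using Matrix.rank_le_card_height (quasiVandermonde C z)ᵀ

theorem IndependentPoints.exists_interpolation {C : Finset (Fin m → ℕ)} {z : Fin r → Fin m → ℂ}
    (hz : IndependentPoints C z) :
    ∃ L : Matrix (Fin r) ↥C ℂ, L * quasiVandermonde C z = 1 :=
  Matrix.exists_mul_eq_one_of_rank_eq_card _ (by simpa [IndependentPoints] using hz)

/-- A left inverse of the Vandermonde factor recovers the invertible `diagonal c` from the product.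
-/
theorem le_rank_quasiHankel_expArray {C : Finset (Fin m → ℕ)} {c : Fin r → ℂ}
    {z : Fin r → Fin m → ℂ} (hc : ∀ k, c k ≠ 0) (hz : IndependentPoints C z) :
    r ≤ (quasiHankel C (expArray (C + C) c z)).rank := by
  obtain ⟨L, hL⟩ := hz.exists_interpolation
  have hD : Matrix.diagonal c = L * (quasiHankel C (expArray (C + C) c z) * Lᵀ) := by
    have hL' : (quasiVandermonde C z)ᵀ * Lᵀ = 1 := by
      rw [← Matrix.transpose_mul, hL, Matrix.transpose_one]
    rw [quasiHankel_expArray, Matrix.mul_assoc, hL', Matrix.mul_one, ← Matrix.mul_assoc, hL,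
      Matrix.one_mul]
  have hr : (Matrix.diagonal c).rank = r := by
    rw [Matrix.rank_of_isUnit, Fintype.card_fin]
    rw [Matrix.isUnit_iff_isUnit_det, Matrix.det_diagonal]
    exact (Finset.prod_ne_zero_iff.2 fun k _ => hc k).isUnit
  calc r = (Matrix.diagonal c).rank := hr.symm
    _ = (L * (quasiHankel C (expArray (C + C) c z) * Lᵀ)).rank := by rw [← hD]
    _ ≤ _ := (Matrix.rank_mul_le_right _ _).trans (Matrix.rank_mul_le_left _ _)

end Monomials

/-! ### Lower bound and uniqueness -/

section Completion

variable {m d r : ℕ} {c : Fin r → ℂ} {z : Fin r → Fin m → ℂ}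
  {g : ↥(trgSet m d + trgSet m d) → ℂ}

theorem isCompletion_expArray :
    IsCompletion (expArray (trgSet m d) c z) (expArray (trgSet m d + trgSet m d) c z) :=
  fun _ => rfl

theorem quasiHankel_submatrix_of_isCompletion (hg : IsCompletion (expArray (trgSet m d) c z) g)
    {s : ℕ} (hs : s ≤ d) (hsd : s + s ≤ d) :
    (quasiHankel (trgSet m d) g).submatrix (fun α => ⟨α.1, trgSet_mono hs α.2⟩)
      (fun α => ⟨α.1, trgSet_mono hs α.2⟩) =
      quasiHankel (trgSet m s) (expArray (trgSet m s + trgSet m s) c z) := by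
  ext α β
  exact hg ⟨α.1 + β.1, add_mem_trgSet α.2 β.2 hsd⟩

theorem le_rank_of_isCompletion (hg : IsCompletion (expArray (trgSet m d) c z) g)
    (hc : ∀ k, c k ≠ 0) {s : ℕ} (hsd : s + s ≤ d) (hz : IndependentPoints (trgSet m s) z) :
    r ≤ (quasiHankel (trgSet m d) g).rank := by
  refine (le_rank_quasiHankel_expArray hc hz).trans ?_
  rw [← quasiHankel_submatrix_of_isCompletion hg (by omega) hsd]
  exact Matrix.rank_submatrix_le _ _ _

/-- In a completion of rank `r`, a combination of columns that vanishes on the rows of degree at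
most `s` vanishes. -/
theorem mulVec_eq_zero_of_isCompletion (hg : IsCompletion (expArray (trgSet m d) c z) g)
    (hc : ∀ k, c k ≠ 0) {s : ℕ} (hsd : s + s ≤ d) (hz : IndependentPoints (trgSet m s) z)
    (hr : (quasiHankel (trgSet m d) g).rank ≤ r) (x : ↥(trgSet m d) → ℂ)
    (hx : ∀ α : ↥(trgSet m d), α.1 ∈ trgSet m s → (quasiHankel (trgSet m d) g *ᵥ x) α = 0) :
    quasiHankel (trgSet m d) g *ᵥ x = 0 := by
  have hs : s ≤ d := by omega
  let f : ↥(trgSet m s) → ↥(trgSet m d) := fun α => ⟨α.1, trgSet_mono hs α.2⟩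
  have hrf : r ≤ ((quasiHankel (trgSet m d) g).submatrix f id).rank := by
    have h1 := le_rank_quasiHankel_expArray hc hz
    rw [← quasiHankel_submatrix_of_isCompletion hg hs hsd] at h1
    exact h1.trans
      (Matrix.rank_submatrix_le ((quasiHankel (trgSet m d) g).submatrix f id) id f)
  exact Matrix.mulVec_eq_zero_of_rank_le_rank_submatrix _ f (hr.trans hrf) x
    fun α => hx (f α) α.2

/-- A completion of rank `r` is canonical as soon as the points are independent in a degree `s`
with `2 s + 1 ≤ d`. -/
theorem eq_expArray_of_rank_le (hg : IsCompletion (expArray (trgSet m d) c z) g)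
    (hc : ∀ k, c k ≠ 0) {s : ℕ} (hsd : 2 * s + 1 ≤ d) (hz : IndependentPoints (trgSet m s) z)
    (hr : (quasiHankel (trgSet m d) g).rank ≤ r) :
    g = expArray (trgSet m d + trgSet m d) c z := by
  obtain ⟨L, hL⟩ := hz.exists_interpolation
  have hLk : ∀ k j, ∑ δ : ↥(trgSet m s), L k δ * monom (z j) δ.1 = if k = j then 1 else 0 := by
    intro k j
    have := congrFun (congrFun hL k) j
    simpa [Matrix.mul_apply, quasiVandermonde, Matrix.one_apply] using this
  -- the array, extended by zero
  obtain ⟨G, hGg⟩ : ∃ G : (Fin m → ℕ) → ℂ,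
      ∀ α (h : α ∈ trgSet m d + trgSet m d), G α = g ⟨α, h⟩ :=
    ⟨fun α => if h : α ∈ trgSet m d + trgSet m d then g ⟨α, h⟩ else 0, fun α h => dif_pos h⟩
  have hGh : ∀ α ∈ trgSet m d, G α = ∑ k, c k * monom (z k) α := by
    intro α h
    rw [hGg α (trgSet_subset_add_self m d h)]
    exact hg ⟨α, h⟩
  -- `W` is the column space pulled back to functions on all of `ℕ^m`, so that shifts can be written
  -- freely.
  obtain ⟨W, hW, hcol⟩ : ∃ W : Submodule ℂ ((Fin m → ℕ) → ℂ),
      (∀ w ∈ W, (∀ α ∈ trgSet m s, w α = 0) → ∀ α ∈ trgSet m d, w α = 0) ∧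
      ∀ β ∈ trgSet m d, (fun α => G (α + β)) ∈ W := by
    refine ⟨(LinearMap.range (quasiHankel (trgSet m d) g).mulVecLin).comap
      (LinearMap.funLeft ℂ ℂ fun α : ↥(trgSet m d) => α.1), ?_, ?_⟩
    · rintro w ⟨x, hx⟩ h α hα
      have hxw : ∀ α : ↥(trgSet m d), (quasiHankel (trgSet m d) g *ᵥ x) α = w α.1 :=
        fun α => congrFun hx α
      rw [← hxw ⟨α, hα⟩, mulVec_eq_zero_of_isCompletion hg hc (by omega) hz hr x
        fun α hα => (hxw α).trans (h α.1 hα)]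
      rfl
    · intro β hβ
      refine ⟨Pi.single ⟨β, hβ⟩ 1, ?_⟩
      funext α
      rw [Matrix.mulVecLin_apply, Matrix.mulVec_single_one]
      exact (hGg _ (Finset.add_mem_add α.2 hβ)).symm
  -- Combination of columns dual to the points.
  let u : Fin r → (Fin m → ℕ) → ℂ := fun k α => ∑ δ : ↥(trgSet m s), L k δ * G (α + δ.1)
  have huW : ∀ (k : Fin r) (ε : Fin m → ℕ), ε ∈ trgSet m 1 → (fun α => u k (α + ε)) ∈ W := by
    intro k ε hε
    have : (fun α => u k (α + ε)) =
        ∑ δ : ↥(trgSet m s), L k δ • fun α => G (α + (ε + δ.1)) := by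
      funext α
      simp only [u, Finset.sum_apply, Pi.smul_apply, smul_eq_mul, add_assoc]
    rw [this]
    exact Submodule.sum_mem _ fun δ _ => Submodule.smul_mem _ _
      (hcol _ (add_mem_trgSet hε δ.2 (by omega)))
  -- Only known entries occur, since `(s + 1) + s ≤ d`.
  have hu : ∀ k, ∀ α ∈ trgSet m (s + 1), u k α = c k * monom (z k) α := by
    intro k α hα
    calc u k α = ∑ δ : ↥(trgSet m s), L k δ * ∑ j, c j * monom (z j) (α + δ.1) :=
          Finset.sum_congr rfl fun δ _ => by
            rw [hGh _ (add_mem_trgSet hα δ.2 (by omega))]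
      _ = ∑ j, c j * monom (z j) α * ∑ δ : ↥(trgSet m s), L k δ * monom (z j) δ.1 := by
          simp only [Finset.mul_sum, monom_add]
          rw [Finset.sum_comm]
          exact Finset.sum_congr rfl fun _ _ => Finset.sum_congr rfl fun _ _ => by ring
      _ = _ := by
          simp only [hLk, mul_ite, mul_one, mul_zero, Finset.sum_ite_eq, Finset.mem_univ, if_true]
  have hu0W : ∀ k, u k ∈ W := fun k => by
    have h0 := huW k 0 (mem_trgSet.2 (by simp))
    simp only [add_zero] at h0
    exact h0
  -- Both sides lie in `W` and agree in degrees at most `s`, by `hu`.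
  have hshift : ∀ k i, ∀ α ∈ trgSet m d, u k (α + Pi.single i 1) = z k i * u k α := by
    intro k i α hα
    have hmem := Submodule.sub_mem _ (huW k _ (single_mem_trgSet i))
      (Submodule.smul_mem _ (z k i) (hu0W k))
    refine sub_eq_zero.1 (hW _ hmem (fun α hα => ?_) α hα)
    simp only [Pi.sub_apply, Pi.smul_apply, smul_eq_mul]
    rw [hu k _ (add_mem_trgSet hα (single_mem_trgSet i) le_rfl),
      hu k _ (trgSet_mono (Nat.le_succ s) hα), monom_add, monom_single]
    ring
  have hexp : ∀ n ≤ d, ∀ β ∈ trgSet m n, ∀ α ∈ trgSet m d,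
      G (α + β) = ∑ k, monom (z k) β * u k α := by
    have step : ∀ β ∈ trgSet m d, (∀ α ∈ trgSet m s,
        G (α + β) = ∑ k, monom (z k) β * u k α) → ∀ α ∈ trgSet m d,
        G (α + β) = ∑ k, monom (z k) β * u k α := by
      intro β hβ h α hα
      have hmem := Submodule.sub_mem _ (hcol β hβ)
        (Submodule.sum_mem (t := Finset.univ) _ fun k _ =>
          Submodule.smul_mem _ (monom (z k) β) (hu0W k))
      have := hW _ hmem (fun α hα => by
        simpa only [Pi.sub_apply, Finset.sum_apply, Pi.smul_apply, smul_eq_mul, sub_eq_zero]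
          using h α hα) α hα
      simpa only [Pi.sub_apply, Finset.sum_apply, Pi.smul_apply, smul_eq_mul, sub_eq_zero]
        using this
    intro n
    induction n with
    | zero =>
      intro _ β hβ
      refine step β (trgSet_mono (Nat.zero_le d) hβ) fun α hα => ?_
      rw [hGh _ (add_mem_trgSet hα hβ (by omega))]
      refine Finset.sum_congr rfl fun k _ => ?_
      rw [hu k α (trgSet_mono (Nat.le_succ s) hα), monom_add]
      ring
    | succ n ih =>
      intro hn β hβ
      by_cases hβn : β ∈ trgSet m n
      · exact ih (by omega) β hβn
      obtain ⟨γ, hγ, i, rfl⟩ := exists_add_single_of_mem_trgSet_succ hβ hβn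
      refine step _ (trgSet_mono hn hβ) fun α hα => ?_
      -- Move the shift from the column index to the row index; `α + e_i` still has degree at most
      -- `d`.
      rw [add_comm γ, ← add_assoc,
        ih (by omega) γ hγ _ (add_mem_trgSet hα (single_mem_trgSet i) (by omega))]
      refine Finset.sum_congr rfl fun k _ => ?_
      rw [hshift k i α (trgSet_mono (by omega) hα), monom_add, monom_single]
      ring
  have hu_all : ∀ k, ∀ α ∈ trgSet m d, u k α = c k * monom (z k) α := by
    intro k α hα
    -- Swap the roles of row `α` and column `δ`, then expand column `α` by `hexp`, where `u` is
    -- needed only in degrees at most `s`.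
    calc u k α = ∑ δ : ↥(trgSet m s), L k δ * ∑ j, monom (z j) α * (c j * monom (z j) δ.1) :=
          Finset.sum_congr rfl fun δ _ => by
            rw [add_comm α, hexp d le_rfl α hα _ (trgSet_mono (by omega) δ.2)]
            congr 1
            exact Finset.sum_congr rfl fun j _ => by
              rw [hu j _ (trgSet_mono (Nat.le_succ s) δ.2)]
      _ = ∑ j, c j * monom (z j) α * ∑ δ : ↥(trgSet m s), L k δ * monom (z j) δ.1 := by
          simp only [Finset.mul_sum]
          rw [Finset.sum_comm]
          exact Finset.sum_congr rfl fun _ _ => Finset.sum_congr rfl fun _ _ => by ring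
      _ = _ := by
          simp only [hLk, mul_ite, mul_one, mul_zero, Finset.sum_ite_eq, Finset.mem_univ, if_true]
  funext ⟨η, hη⟩
  obtain ⟨α, hα, β, hβ, rfl⟩ := Finset.mem_add.1 hη
  rw [← hGg _ hη, hexp d le_rfl β hβ α hα]
  refine Finset.sum_congr rfl fun k _ => ?_
  rw [hu_all k α hα, monom_add]
  ring

theorem eq_expArray_of_isCompletion_zero {g : ↥(trgSet m 0 + trgSet m 0) → ℂ}
    (hg : IsCompletion (expArray (trgSet m 0) c z) g) :
    g = expArray (trgSet m 0 + trgSet m 0) c z := by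
  funext ⟨η, hη⟩
  obtain ⟨α, hα, β, hβ, rfl⟩ := Finset.mem_add.1 hη
  exact hg ⟨α + β, add_mem_trgSet hα hβ le_rfl⟩

end Completion

theorem mainTheorem3 (m d r : ℕ) (h : ↥(trgSet m d) → ℂ)
    (c : Fin r → ℂ) (z : Fin r → Fin m → ℂ)
    (hform : h = expArray (trgSet m d) c z)
    (hc : ∀ k, c k ≠ 0)
    (hz : IndependentPoints (trgSet m (d / 2)) z) :
    (IsLeast {ρ : ℕ | ∃ g : ↥(trgSet m d + trgSet m d) → ℂ,
          IsCompletion h g ∧ (quasiHankel (trgSet m d) g).rank = ρ} r ∧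
      IsMinRankCompletion h (expArray (trgSet m d + trgSet m d) c z) ∧
      (quasiHankel (trgSet m d) (expArray (trgSet m d + trgSet m d) c z)).rank = r) ∧
    (Odd d → ∀ g : ↥(trgSet m d + trgSet m d) → ℂ, IsMinRankCompletion h g →
      g = expArray (trgSet m d + trgSet m d) c z) ∧
    (Even d → IndependentPoints (trgSet m (d / 2 - 1)) z →
      ∀ g : ↥(trgSet m d + trgSet m d) → ℂ, IsMinRankCompletion h g →
        g = expArray (trgSet m d + trgSet m d) c z) := by
  subst hform
  have hlow : ∀ g, IsCompletion (expArray (trgSet m d) c z) g →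
      r ≤ (quasiHankel (trgSet m d) g).rank := fun g hg =>
    le_rank_of_isCompletion hg hc (by omega) hz
  have hrank : (quasiHankel (trgSet m d) (expArray (trgSet m d + trgSet m d) c z)).rank = r :=
    le_antisymm (rank_quasiHankel_expArray_le _ c z) (hlow _ isCompletion_expArray)
  have hmin : ∀ g, IsMinRankCompletion (expArray (trgSet m d) c z) g →
      (quasiHankel (trgSet m d) g).rank ≤ r := fun g hg =>
    (hg.2 _ isCompletion_expArray).trans hrank.le
  refine ⟨⟨⟨⟨_, isCompletion_expArray, hrank⟩, ?_⟩,
    ⟨isCompletion_expArray, fun g' hg' => hrank.le.trans (hlow g' hg')⟩, hrank⟩, ?_, ?_⟩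
  · rintro _ ⟨g, hg, rfl⟩
    exact hlow g hg
  · rintro ⟨k, hk⟩ g hg
    exact eq_expArray_of_rank_le hg.1 hc (by omega) hz (hmin g hg)
  · rintro ⟨k, hk⟩ hz' g hg
    -- For `d = 0` the truncated `d / 2 - 1` is `0`, so `2s + 1 ≤ d` fails; but then `2A = A` and
    -- every entry is known.
    rcases Nat.eq_zero_or_pos d with rfl | hd
    · exact eq_expArray_of_isCompletion_zero hg.1
    · exact eq_expArray_of_rank_le hg.1 hc (by omega) hz' (hmin g hg)
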